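/- Corollary 4.4. Let $(M,J,g)$ be a locally conformal Kähler manifold: a Hermitian manifold (i.e. $J$ is an integrable almost complex structure with $g(JX,JY)=g(X,Y)$) together with a closed $1$-form $\omega$, the Lee form, such that $d\Omega=\omega\wedge\Omega$, where $\Omega(X,Y)=g(X,JY)$. Let $\pi:M\to B$ be a Lagrangian Riemannian submersion onto a Riemannian manifold $(B,g_B)$, that is, a smooth surjective map of maximal rank whose differential preserves the lengths of vectors in $(\ker\pi_*)^\perp$, and such that $J(\ker\pi_*)=(\ker\pi_*)^\perp$. Assume that the Lee vector field $B_1=\omega^\sharp$ is vertical, i.e. $B_1\in\ker\pi_*$ at every point. Let $\nabla$ be the Levi-Civita connection of $g$, let $\mathcal V,\mathcal H$ be the orthogonal projections of $TM$ onto $\ker\pi_*$ and $(\ker\pi_*)^\perp$, let $$\mathcal T_EF=\mathcal H\nabla_{\mathcal VE}\mathcal VF+\mathcal V\nabla_{\mathcal VE}\mathcal HF$$ be O'Neill's tensor, and let $$(\nabla\pi_*)(E,F)=\nabla^\pi_E\,\pi_*F-\pi_*(\nabla_EF)$$ be the second fundamental form of $\pi$, where $\nabla^\pi$ is the connection on $\pi^{-1}(TB)$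 pulled back from the Levi-Civita connection of $g_B$. Then the following assertions are equivalent: (a) $\ker\pi_*$ defines a totally geodesic foliation on $M$, i.e. it is involutive and $\nabla_VW\in\Gamma(\ker\pi_*)$ for all $V,W\in\Gamma(\ker\pi_*)$; (b) $\mathcal T_V JW=0$ for all $V,W\in\Gamma(\ker\pi_*)$; (c) $(\nabla\pi_*)(V,JX)=0$ for all $V\in\Gamma(\ker\pi_*)$ and $X\in\Gamma((\ker\pi_*)^\perp)$. -/

import Mathlib

open Bundle VectorField
open scoped Manifold ContDiff Topology

noncomputable section

namespace LagrangianSubmersion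

section Riem
variable {E : Type*} [NormedAddCommGroup E] [NormedSpace ℝ E] [FiniteDimensional ℝ E]
  {M : Type*} [TopologicalSpace M] [ChartedSpace E M] [IsManifold 𝓘(ℝ, E) ∞ M]

instance finiteDimensional_tangentSpace (x : M) : FiniteDimensional ℝ (TangentSpace 𝓘(ℝ, E) x) :=
  inferInstanceAs (FiniteDimensional ℝ E)

variable [RiemannianBundle (fun x : M => TangentSpace 𝓘(ℝ, E) x)]

/-- The right-hand side of the Koszul formula: `X⟨Y,Z⟩ + Y⟨X,Z⟩ - Z⟨X,Y⟩ + ⟨[X,Y],Z⟩ - ⟨[X,Z],Y⟩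
- ⟨[Y,Z],X⟩`. -/
def koszul (X Y Z : Π x : M, TangentSpace 𝓘(ℝ, E) x) (x : M) : ℝ :=
  d% (fun y => inner ℝ (Y y) (Z y)) x (X x) + d% (fun y => inner ℝ (X y) (Z y)) x (Y x)
    - d% (fun y => inner ℝ (X y) (Y y)) x (Z x)
    + inner ℝ (mlieBracket 𝓘(ℝ, E) X Y x) (Z x) - inner ℝ (mlieBracket 𝓘(ℝ, E) X Z x) (Y x)
    - inner ℝ (mlieBracket 𝓘(ℝ, E) Y Z x) (X x)

variable [IsContMDiffRiemannianBundle 𝓘(ℝ, E) ∞ E (fun x : M => TangentSpace 𝓘(ℝ, E) x)]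

theorem mdiff_inner {X Y : Π x : M, TangentSpace 𝓘(ℝ, E) x} {x : M}
    (hX : MDiffAt (T% X) x) (hY : MDiffAt (T% Y) x) :
    MDiffAt (fun y => inner ℝ (X y) (Y y)) x :=
  MDifferentiableAt.inner_bundle (E := fun x : M => TangentSpace 𝓘(ℝ, E) x) (F := E)
    (IB := 𝓘(ℝ, E)) (b := fun y => y) hX hY

theorem koszul_tensorial_right {X Y : Π x : M, TangentSpace 𝓘(ℝ, E) x} {x : M}
    (hX : MDiffAt (T% X) x) (hY : MDiffAt (T% Y) x) :
    TensorialAt 𝓘(ℝ, E) E (fun Z => koszul X Y Z x) x where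
  smul {f Z} hf hZ := by
    have : CompleteSpace E := FiniteDimensional.complete ℝ E
    simp only [koszul, mlieBracket_smul_right hf hZ, Pi.smul_apply', inner_smul_right, inner_smul_left, conj_trivial, inner_add_left,
      mvfderiv_fun_mul hf (mdiff_inner hY hZ), mvfderiv_fun_mul hf (mdiff_inner hX hZ)]
    simp [real_inner_comm]
    ring
  add {Z Z'} hZ hZ' := by
    have : CompleteSpace E := FiniteDimensional.complete ℝ E
    simp only [koszul, mlieBracket_add_right hZ hZ', Pi.add_apply, inner_add_right, inner_add_left,
      mvfderiv_fun_add (mdiff_inner hY hZ) (mdiff_inner hY hZ'),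
      mvfderiv_fun_add (mdiff_inner hX hZ) (mdiff_inner hX hZ')]
    simp
    ring

theorem koszul_tensorial_left {Y Z : Π x : M, TangentSpace 𝓘(ℝ, E) x} {x : M}
    (hY : MDiffAt (T% Y) x) (hZ : MDiffAt (T% Z) x) :
    TensorialAt 𝓘(ℝ, E) E (fun X => koszul X Y Z x) x where
  smul {f X} hf hX := by
    have : CompleteSpace E := FiniteDimensional.complete ℝ E
    simp only [koszul, mlieBracket_smul_left hf hX, Pi.smul_apply', inner_smul_right, inner_smul_left, conj_trivial, inner_add_left,
      mvfderiv_fun_mul hf (mdiff_inner hX hZ), mvfderiv_fun_mul hf (mdiff_inner hX hY)]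
    simp [real_inner_comm]
    ring
  add {X X'} hX hX' := by
    have : CompleteSpace E := FiniteDimensional.complete ℝ E
    simp only [koszul, mlieBracket_add_left hX hX', Pi.add_apply, inner_add_right, inner_add_left,
      mvfderiv_fun_add (mdiff_inner hX hZ) (mdiff_inner hX' hZ),
      mvfderiv_fun_add (mdiff_inner hX hY) (mdiff_inner hX' hY)]
    simp
    ring

theorem koszul_add_mid {X Y Y' Z : Π x : M, TangentSpace 𝓘(ℝ, E) x} {x : M}
    (hX : MDiffAt (T% X) x) (hY : MDiffAt (T% Y) x) (hY' : MDiffAt (T% Y') x)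
    (hZ : MDiffAt (T% Z) x) :
    koszul X (Y + Y') Z x = koszul X Y Z x + koszul X Y' Z x := by
  have : CompleteSpace E := FiniteDimensional.complete ℝ E
  simp only [koszul, mlieBracket_add_left hY hY', mlieBracket_add_right hY hY', Pi.add_apply,
    inner_add_right, inner_add_left, map_add,
    mvfderiv_fun_add (mdiff_inner hY hZ) (mdiff_inner hY' hZ),
    mvfderiv_fun_add (mdiff_inner hX hY) (mdiff_inner hX hY')]
  simp
  ring

theorem koszul_smul_mid {X Y Z : Π x : M, TangentSpace 𝓘(ℝ, E) x} {f : M → ℝ} {x : M}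
    (hX : MDiffAt (T% X) x) (hY : MDiffAt (T% Y) x) (hf : MDiffAt f x)
    (hZ : MDiffAt (T% Z) x) :
    koszul X (f • Y) Z x = f x * koszul X Y Z x + 2 * d% f x (X x) * inner ℝ (Y x) (Z x) := by
  have : CompleteSpace E := FiniteDimensional.complete ℝ E
  simp only [koszul, mlieBracket_smul_left hf hY, mlieBracket_smul_right hf hY, Pi.smul_apply',
    inner_smul_right, inner_smul_left, conj_trivial, inner_add_left, map_smul,
    mvfderiv_fun_mul hf (mdiff_inner hY hZ), mvfderiv_fun_mul hf (mdiff_inner hX hY)]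
  simp [real_inner_comm]
  ring

open Classical in
/-- The endomorphism `v ↦ ∇_v Y` of `T_xM` given by the Koszul formula
`2⟨∇_v Y, w⟩ = koszul v Y w`, expanded in an orthonormal basis of `T_xM`. -/
def leviCivitaFun (Y : Π x : M, TangentSpace 𝓘(ℝ, E) x) (x : M) :
    TangentSpace 𝓘(ℝ, E) x →L[ℝ] TangentSpace 𝓘(ℝ, E) x :=
  if hY : MDiffAt (T% Y) x then
    (1 / 2 : ℝ) • ∑ i, ((TensorialAt.mkHom₂ (fun X Z => koszul X Y Z x) x
      (fun _ hZ => koszul_tensorial_left hY hZ)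
      (fun _ hX => koszul_tensorial_right hX hY)).flip
        (stdOrthonormalBasis ℝ (TangentSpace 𝓘(ℝ, E) x) i)).smulRight
        (stdOrthonormalBasis ℝ (TangentSpace 𝓘(ℝ, E) x) i)
  else 0

theorem inner_leviCivitaFun {X Y Z : Π x : M, TangentSpace 𝓘(ℝ, E) x} {x : M}
    (hX : MDiffAt (T% X) x) (hY : MDiffAt (T% Y) x) (hZ : MDiffAt (T% Z) x) :
    2 * inner ℝ (leviCivitaFun Y x (X x)) (Z x) = koszul X Y Z x := by
  rw [← TensorialAt.mkHom₂_apply (Φ := fun X Z => koszul X Y Z x) (x := x)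
      (fun _ hZ => koszul_tensorial_left hY hZ)
      (fun _ hX => koszul_tensorial_right hX hY) hX hZ]
  set B := TensorialAt.mkHom₂ (fun X Z => koszul X Y Z x) x
      (fun _ hZ => koszul_tensorial_left hY hZ)
      (fun _ hX => koszul_tensorial_right hX hY) with hB
  have h : leviCivitaFun Y x (X x) = (1 / 2 : ℝ) • ∑ i, B (X x)
      (stdOrthonormalBasis ℝ (TangentSpace 𝓘(ℝ, E) x) i) •
        stdOrthonormalBasis ℝ (TangentSpace 𝓘(ℝ, E) x) i := by
    simp [leviCivitaFun, hY, hB]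
  rw [h]
  conv_rhs => rw [← (stdOrthonormalBasis ℝ (TangentSpace 𝓘(ℝ, E) x)).sum_repr (Z x)]
  simp [inner_smul_left, sum_inner, OrthonormalBasis.repr_apply_apply, mul_comm]

theorem mdiff_extend {x : M} (v : TangentSpace 𝓘(ℝ, E) x) :
    MDiffAt (T% (FiberBundle.extend E v)) x :=
  FiberBundle.mdifferentiableAt_extend 𝓘(ℝ, E) E v

theorem leviCivitaFun_ext {x : M} {v w : TangentSpace 𝓘(ℝ, E) x}
    (h : ∀ Z : Π x : M, TangentSpace 𝓘(ℝ, E) x, MDiffAt (T% Z) x →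
      2 * inner ℝ v (Z x) = 2 * inner ℝ w (Z x)) : v = w := by
  refine ext_inner_right ℝ fun z => ?_
  have := h (FiberBundle.extend E z) (mdiff_extend z)
  rw [FiberBundle.extend_apply_self] at this
  linarith

variable (E M) in
/-- The Levi-Civita connection of the Riemannian manifold `M`;
`leviCivita E M Y x v` is `∇_v Y` at `x`, for a tangent vector `v` at `x`. -/
def leviCivita : CovariantDerivative 𝓘(ℝ, E) E (fun x : M => TangentSpace 𝓘(ℝ, E) x) where
  toFun := leviCivitaFun
  isCovariantDerivativeOnUniv :=
    { add := by
        intro Y Y' x hY hY' _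
        ext v
        refine leviCivitaFun_ext fun Z hZ => ?_
        have hv := mdiff_extend v
        have e := FiberBundle.extend_apply_self E v
        rw [add_apply, inner_add_left, mul_add, ← e,
          inner_leviCivitaFun hv (mdifferentiableAt_add_section hY hY') hZ,
          inner_leviCivitaFun hv hY hZ, inner_leviCivitaFun hv hY' hZ,
          koszul_add_mid hv hY hY' hZ]
      leibniz := by
        intro Y f x hY hf _
        ext v
        refine leviCivitaFun_ext fun Z hZ => ?_
        have hv := mdiff_extend v
        have e := FiberBundle.extend_apply_self E v
        rw [add_apply, smul_apply,
          ContinuousLinearMap.smulRight_apply, inner_add_left, mul_add, inner_smul_left,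
          inner_smul_left, conj_trivial, conj_trivial, ← e,
          inner_leviCivitaFun hv (hf.smul_section hY) hZ, mul_left_comm,
          inner_leviCivitaFun hv hY hZ, koszul_smul_mid hv hY hf hZ]
        ring }

theorem inner_leviCivita {X Y Z : Π x : M, TangentSpace 𝓘(ℝ, E) x} {x : M}
    (hX : MDiffAt (T% X) x) (hY : MDiffAt (T% Y) x) (hZ : MDiffAt (T% Z) x) :
    2 * inner ℝ (leviCivita E M Y x (X x)) (Z x) = koszul X Y Z x :=
  inner_leviCivitaFun hX hY hZ

/-- The Levi-Civita connection is torsion-free. -/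
theorem leviCivita_torsion {X Y : Π x : M, TangentSpace 𝓘(ℝ, E) x} {x : M}
    (hX : MDiffAt (T% X) x) (hY : MDiffAt (T% Y) x) :
    leviCivita E M Y x (X x) - leviCivita E M X x (Y x) = mlieBracket 𝓘(ℝ, E) X Y x := by
  refine leviCivitaFun_ext fun Z hZ => ?_
  rw [inner_sub_left, mul_sub, inner_leviCivita hX hY hZ, inner_leviCivita hY hX hZ]
  simp only [koszul, mlieBracket_swap_apply (V := Y) (W := X), inner_neg_left,
    fun y => real_inner_comm (X y) (Y y)]
  ring

/-- The Levi-Civita connection is compatible with the metric. -/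
theorem leviCivita_metric {X Y Z : Π x : M, TangentSpace 𝓘(ℝ, E) x} {x : M}
    (hX : MDiffAt (T% X) x) (hY : MDiffAt (T% Y) x) (hZ : MDiffAt (T% Z) x) :
    d% (fun y => inner ℝ (Y y) (Z y)) x (X x) =
      inner ℝ (leviCivita E M Y x (X x)) (Z x) + inner ℝ (Y x) (leviCivita E M Z x (X x)) := by
  have h1 := inner_leviCivita hX hY hZ
  have h2 := inner_leviCivita hX hZ hY
  rw [real_inner_comm]  at h2
  simp only [koszul, mlieBracket_swap_apply (V := Z) (W := Y), inner_neg_left,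
    fun y => real_inner_comm (Y y) (Z y)] at h1 h2 ⊢
  linarith

/-- `∇_X Y` for vector fields `X`, `Y`. -/
def covDeriv (X Y : Π x : M, TangentSpace 𝓘(ℝ, E) x) (x : M) : TangentSpace 𝓘(ℝ, E) x :=
  leviCivita E M Y x (X x)

end Riem

section Foliation

variable {E : Type*} [NormedAddCommGroup E] [NormedSpace ℝ E] [FiniteDimensional ℝ E]
  {M : Type*} [TopologicalSpace M] [ChartedSpace E M] [IsManifold 𝓘(ℝ, E) ∞ M]

/-- Smooth vector fields on `M`, i.e. elements of `Γ(TM)`. -/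
def IsSmoothField (X : Π x : M, TangentSpace 𝓘(ℝ, E) x) : Prop :=
  ContMDiff 𝓘(ℝ, E) (𝓘(ℝ, E).prod 𝓘(ℝ, E)) ∞ (fun x => (TotalSpace.mk' E x (X x)))

/-- `X ∈ Γ(D)`: `X` is a smooth vector field with values in the distribution `D`. -/
structure IsSection (D : Π x : M, Submodule ℝ (TangentSpace 𝓘(ℝ, E) x))
    (X : Π x : M, TangentSpace 𝓘(ℝ, E) x) : Prop where
  smooth : IsSmoothField X
  mem : ∀ x, X x ∈ D x

variable [RiemannianBundle (fun x : M => TangentSpace 𝓘(ℝ, E) x)]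
  [IsContMDiffRiemannianBundle 𝓘(ℝ, E) ∞ E (fun x : M => TangentSpace 𝓘(ℝ, E) x)]

/-- The distribution `D` defines a totally geodesic foliation: it is involutive, and the second
fundamental form of its leaves vanishes, i.e. `∇_V W ∈ Γ(D)` for all `V, W ∈ Γ(D)`. -/
structure IsTotallyGeodesicFoliation (D : Π x : M, Submodule ℝ (TangentSpace 𝓘(ℝ, E) x)) :
    Prop where
  involutive : ∀ V W : Π x : M, TangentSpace 𝓘(ℝ, E) x, IsSection D V → IsSection D W →
    ∀ x, mlieBracket 𝓘(ℝ, E) V W x ∈ D x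
  covDeriv_mem : ∀ V W : Π x : M, TangentSpace 𝓘(ℝ, E) x, IsSection D V → IsSection D W →
    ∀ x, covDeriv V W x ∈ D x

end Foliation

section LCK

variable {E : Type*} [NormedAddCommGroup E] [NormedSpace ℝ E] [FiniteDimensional ℝ E]
  {M : Type*} [TopologicalSpace M] [ChartedSpace E M] [IsManifold 𝓘(ℝ, E) ∞ M]
  [RiemannianBundle (fun x : M => TangentSpace 𝓘(ℝ, E) x)]

/-- `J X` for an endomorphism field `J` and a vector field `X`. -/
def applyField (J : Π x : M, TangentSpace 𝓘(ℝ, E) x →L[ℝ] TangentSpace 𝓘(ℝ, E) x)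
    (X : Π x : M, TangentSpace 𝓘(ℝ, E) x) (x : M) : TangentSpace 𝓘(ℝ, E) x :=
  J x (X x)

/-- `(M, J, g)` is a Hermitian manifold: `J` is a smooth almost complex structure, orthogonal for
the metric `g` of `M`, and integrable (its Nijenhuis tensor vanishes). -/
structure IsHermitian (J : Π x : M, TangentSpace 𝓘(ℝ, E) x →L[ℝ] TangentSpace 𝓘(ℝ, E) x) :
    Prop where
  smooth : ContMDiff 𝓘(ℝ, E) (𝓘(ℝ, E).prod 𝓘(ℝ, E →L[ℝ] E)) ∞
    (fun x => (TotalSpace.mk' (E →L[ℝ] E) x (J x) : TotalSpace (E →L[ℝ] E)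
      (fun x : M => TangentSpace 𝓘(ℝ, E) x →L[ℝ] TangentSpace 𝓘(ℝ, E) x)))
  sq : ∀ (x : M) (v : TangentSpace 𝓘(ℝ, E) x), J x (J x v) = -v
  inner_map : ∀ (x : M) (v w : TangentSpace 𝓘(ℝ, E) x), inner ℝ (J x v) (J x w) = inner ℝ v w
  nijenhuis : ∀ X Y : Π x : M, TangentSpace 𝓘(ℝ, E) x, IsSmoothField X → IsSmoothField Y →
    ∀ x, mlieBracket 𝓘(ℝ, E) (applyField J X) (applyField J Y) x
      - J x (mlieBracket 𝓘(ℝ, E) (applyField J X) Y x)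
      - J x (mlieBracket 𝓘(ℝ, E) X (applyField J Y) x)
      - mlieBracket 𝓘(ℝ, E) X Y x = 0

/-- The Kähler form `Ω(X, Y) = g(X, JY)`. -/
def kahlerForm (J : Π x : M, TangentSpace 𝓘(ℝ, E) x →L[ℝ] TangentSpace 𝓘(ℝ, E) x)
    (X Y : Π x : M, TangentSpace 𝓘(ℝ, E) x) (x : M) : ℝ :=
  inner ℝ (X x) (J x (Y x))

/-- `dΩ(X, Y, Z)`, where `Ω` is the Kähler form. -/
def dKahlerForm (J : Π x : M, TangentSpace 𝓘(ℝ, E) x →L[ℝ] TangentSpace 𝓘(ℝ, E) x)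
    (X Y Z : Π x : M, TangentSpace 𝓘(ℝ, E) x) (x : M) : ℝ :=
  d% (kahlerForm J Y Z) x (X x) + d% (kahlerForm J Z X) x (Y x) + d% (kahlerForm J X Y) x (Z x)
    - kahlerForm J (mlieBracket 𝓘(ℝ, E) X Y) Z x
    - kahlerForm J (mlieBracket 𝓘(ℝ, E) Y Z) X x
    - kahlerForm J (mlieBracket 𝓘(ℝ, E) Z X) Y x

/-- `om` is a Lee form of `(M, J, g)`: a smooth closed `1`-form with `dΩ = om ∧ Ω`. -/
structure IsLeeForm (J : Π x : M, TangentSpace 𝓘(ℝ, E) x →L[ℝ] TangentSpace 𝓘(ℝ, E) x)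
    (om : Π x : M, TangentSpace 𝓘(ℝ, E) x →L[ℝ] ℝ) : Prop where
  smooth : ContMDiff 𝓘(ℝ, E) (𝓘(ℝ, E).prod 𝓘(ℝ, E →L[ℝ] ℝ)) ∞
    (fun x => (TotalSpace.mk' (E →L[ℝ] ℝ) x (om x) : TotalSpace (E →L[ℝ] ℝ)
      (fun x : M => TangentSpace 𝓘(ℝ, E) x →L[ℝ] Bundle.Trivial M ℝ x)))
  closed : ∀ X Y : Π x : M, TangentSpace 𝓘(ℝ, E) x, IsSmoothField X → IsSmoothField Y →
    ∀ x, d% (fun y => om y (Y y)) x (X x) - d% (fun y => om y (X y)) x (Y x)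
      - om x (mlieBracket 𝓘(ℝ, E) X Y x) = 0
  dKahler_eq : ∀ X Y Z : Π x : M, TangentSpace 𝓘(ℝ, E) x,
    IsSmoothField X → IsSmoothField Y → IsSmoothField Z →
    ∀ x, dKahlerForm J X Y Z x = om x (X x) * kahlerForm J Y Z x + om x (Y x) * kahlerForm J Z X x
      + om x (Z x) * kahlerForm J X Y x

/-- The Lee vector field `B₁ = om^♯`, i.e. `g(X, B₁) = om(X)`. -/
def leeField (om : Π x : M, TangentSpace 𝓘(ℝ, E) x →L[ℝ] ℝ) (x : M) : TangentSpace 𝓘(ℝ, E) x :=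
  have : CompleteSpace (TangentSpace 𝓘(ℝ, E) x) := FiniteDimensional.complete ℝ _
  (InnerProductSpace.toDual ℝ (TangentSpace 𝓘(ℝ, E) x)).symm (om x)

end LCK

section Submersion

variable {E : Type*} [NormedAddCommGroup E] [NormedSpace ℝ E] [FiniteDimensional ℝ E]
  {M : Type*} [TopologicalSpace M] [ChartedSpace E M] [IsManifold 𝓘(ℝ, E) ∞ M]
  [RiemannianBundle (fun x : M => TangentSpace 𝓘(ℝ, E) x)]
  {F : Type*} [NormedAddCommGroup F] [NormedSpace ℝ F] [FiniteDimensional ℝ F]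
  {B : Type*} [TopologicalSpace B] [ChartedSpace F B] [IsManifold 𝓘(ℝ, F) ∞ B]
  [RiemannianBundle (fun y : B => TangentSpace 𝓘(ℝ, F) y)]

variable (E F) in
/-- The vertical distribution `ker p_*`. -/
def vertical (p : M → B) (x : M) : Submodule ℝ (TangentSpace 𝓘(ℝ, E) x) :=
  LinearMap.ker (mfderiv 𝓘(ℝ, E) 𝓘(ℝ, F) p x).toLinearMap

variable (E F) in
/-- The horizontal distribution `(ker p_*)^⊥`. -/
def horizontal (p : M → B) (x : M) : Submodule ℝ (TangentSpace 𝓘(ℝ, E) x) :=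
  (vertical E F p x)ᗮ

variable (E F) in
/-- The projection `𝒱` of a vector field to the vertical distribution. -/
def vertProj (p : M → B) (X : Π x : M, TangentSpace 𝓘(ℝ, E) x) (x : M) :
    TangentSpace 𝓘(ℝ, E) x :=
  (vertical E F p x).starProjection (X x)

variable (E F) in
/-- The projection `ℋ` of a vector field to the horizontal distribution. -/
def horProj (p : M → B) (X : Π x : M, TangentSpace 𝓘(ℝ, E) x) (x : M) :
    TangentSpace 𝓘(ℝ, E) x :=
  (horizontal E F p x).starProjection (X x)

variable (E F) in
/-- `p` is a Riemannian submersion: a smooth surjective map, of maximal rank at every point, whose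
differential preserves the lengths of horizontal vectors. -/
structure IsRiemannianSubmersion (p : M → B) : Prop where
  smooth : ContMDiff 𝓘(ℝ, E) 𝓘(ℝ, F) ∞ p
  surjective : Function.Surjective p
  mfderiv_surjective : ∀ x, Function.Surjective (mfderiv 𝓘(ℝ, E) 𝓘(ℝ, F) p x)
  norm_map : ∀ x, ∀ v ∈ horizontal E F p x, ‖mfderiv 𝓘(ℝ, E) 𝓘(ℝ, F) p x v‖ = ‖v‖

variable (E F) in
/-- `p` is a Lagrangian Riemannian submersion: `J (ker p_*) = (ker p_*)^⊥`. -/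
structure IsLagrangianSubmersion
    (J : Π x : M, TangentSpace 𝓘(ℝ, E) x →L[ℝ] TangentSpace 𝓘(ℝ, E) x) (p : M → B) : Prop
    extends IsRiemannianSubmersion E F p where
  map_vertical : ∀ x, (vertical E F p x).map (J x).toLinearMap = horizontal E F p x

variable [IsContMDiffRiemannianBundle 𝓘(ℝ, E) ∞ E (fun x : M => TangentSpace 𝓘(ℝ, E) x)]

variable (E F) in
/-- O'Neill's tensor `𝒯_X Y = ℋ∇_{𝒱X} 𝒱Y + 𝒱∇_{𝒱X} ℋY`. -/
def oneillT (p : M → B) (X Y : Π x : M, TangentSpace 𝓘(ℝ, E) x) (x : M) :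
    TangentSpace 𝓘(ℝ, E) x :=
  horProj E F p (covDeriv (vertProj E F p X) (vertProj E F p Y)) x
    + vertProj E F p (covDeriv (vertProj E F p X) (horProj E F p Y)) x

variable [IsContMDiffRiemannianBundle 𝓘(ℝ, F) ∞ F (fun y : B => TangentSpace 𝓘(ℝ, F) y)]

variable (E F) in
/-- The connection `∇^p` on the pullback bundle `p^{-1}(TB)`, in a direction `v ∈ T_xM`. In the
trivialization of `TB` around `p x`, a section `s` along `p` is a function `σ : M → F`; writing
`s = ∑ σ^k (e_k ∘ p)` in the corresponding frame, the Leibniz rule and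
`∇^p_v (e_k ∘ p) = ∇^B_{p_* v} e_k` give
`∇^p_v s = ∑ dσ^k(v) e_k + ∑ σ^k(x) ∇^B_{p_* v} e_k`. The field `∑ σ^k(x) e_k` is the extension of
the vector `s x` that is constant in the trivialization. -/
def pullbackDeriv (p : M → B) (s : Π x : M, TangentSpace 𝓘(ℝ, F) (p x)) (x : M)
    (v : TangentSpace 𝓘(ℝ, E) x) : TangentSpace 𝓘(ℝ, F) (p x) :=
  (trivializationAt F (fun y : B => TangentSpace 𝓘(ℝ, F) y) (p x)).symm (p x)
      (d% (fun y : M => ((trivializationAt F (fun y : B => TangentSpace 𝓘(ℝ, F) y) (p x))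
        (TotalSpace.mk' F (p y) (s y))).2) x v)
    + leviCivita F B (FiberBundle.extend F (s x)) (p x) (mfderiv 𝓘(ℝ, E) 𝓘(ℝ, F) p x v)

variable (E F) in
/-- The second fundamental form `(∇p_*)(X, Y) = ∇^p_X p_* Y - p_* (∇_X Y)`. -/
def secondFundamentalForm (p : M → B) (X Y : Π x : M, TangentSpace 𝓘(ℝ, E) x) (x : M) :
    TangentSpace 𝓘(ℝ, F) (p x) :=
  pullbackDeriv E F p (fun y => mfderiv 𝓘(ℝ, E) 𝓘(ℝ, F) p y (Y y)) x (X x)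
    - mfderiv 𝓘(ℝ, E) 𝓘(ℝ, F) p x (covDeriv X Y x)

end Submersion

end LagrangianSubmersion

end

open LagrangianSubmersion

/-! Everything reduces to whether `∇_V W` is vertical for vertical `V`, `W`. That condition is (a),
since involutivity follows from it by torsion-freeness (`isTotallyGeodesicFoliation_iff`).

For (b): `JW` is horizontal when `W` is vertical, so `𝒯_V JW` is just `𝒱∇_V JW`. Differentiating
`g(JW, U) = 0` along `V` gives `g(U, ∇_V JW) = -g(JW, ∇_V U)` for vertical `U`
(`inner_covDeriv_of_isSection`). As `J` maps the vertical spaces onto the horizontal ones, the left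
side vanishes for all `U`, `W` exactly when every `∇_V U` is vertical.

For (c): `JX` is vertical when `X` is horizontal, so `π_* JX = 0` and `(∇π_*)(V, JX) = -π_*(∇_V
JX)`. This vanishes iff `∇_V JX` is vertical (`secondFundamentalForm_eq_zero_iff`), and every
vertical field has the form `JX`.

The conditions quantify over global fields while orthogonality is tested on vectors at a point. The
link is `exists_isSection_vertical`: local kernel fields of the coordinate map, cut off by a bump
function. -/

/-- Zeros of the derivative of a smooth map at a point where it is surjective extend to smooth local
fields of zeros of the derivative. -/
theorem exists_contDiffOn_fderiv_apply_eq_zero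
    {E : Type*} [NormedAddCommGroup E] [NormedSpace ℝ E]
    {F : Type*} [NormedAddCommGroup F] [NormedSpace ℝ F] [FiniteDimensional ℝ F]
    {f : E → F} {O : Set E} (hO : IsOpen O) (hf : ContDiffOn ℝ ∞ f O) {z₀ : E} (hz₀ : z₀ ∈ O)
    (hsurj : Function.Surjective (fderiv ℝ f z₀)) {u : E} (hu : fderiv ℝ f z₀ u = 0) :
    ∃ U ⊆ O, IsOpen U ∧ z₀ ∈ U ∧ ∃ w : E → E, ContDiffOn ℝ ∞ w U ∧ w z₀ = u ∧
      ∀ z ∈ U, fderiv ℝ f z (w z) = 0 := by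
  have : CompleteSpace F := FiniteDimensional.complete ℝ F
  have hD : ContDiffOn ℝ ∞ (fderiv ℝ f) O := hf.fderiv_of_isOpen hO (by simp)
  obtain ⟨r, hr⟩ := (fderiv ℝ f z₀).toLinearMap.exists_rightInverse_of_surjective
    (LinearMap.range_eq_top.2 hsurj)
  set R : F →L[ℝ] E := r.toContinuousLinearMap
  have hR : fderiv ℝ f z₀ ∘L R = 1 := by
    ext v
    exact LinearMap.congr_fun hr v
  have hS : ContDiffOn ℝ ∞ (fun z => fderiv ℝ f z ∘L R) O := hD.clm_comp contDiffOn_const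
  -- With `R` a right inverse of `Df` at `z₀`, the map `Df_z ∘ R` stays invertible near `z₀`.
  -- Subtracting `R (Df_z ∘ R)⁻¹ Df_z u` from the constant `u` then kills the image under `Df_z`,
  -- and the correction is zero at `z₀`.
  refine ⟨O ∩ (fun z => fderiv ℝ f z ∘L R) ⁻¹' {T | IsUnit T}, Set.inter_subset_left,
    hS.continuousOn.isOpen_inter_preimage hO Units.isOpen, ⟨hz₀, ?_⟩,
    fun z => u - R (Ring.inverse (fderiv ℝ f z ∘L R) (fderiv ℝ f z u)), ?_, ?_, ?_⟩
  · simp [hR]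
  · have hinv : ContDiffOn ℝ ∞ (fun z => Ring.inverse (fderiv ℝ f z ∘L R))
        (O ∩ (fun z => fderiv ℝ f z ∘L R) ⁻¹' {T | IsUnit T}) := by
      rintro z ⟨hz, T, hT⟩
      have := contDiffAt_ringInverse ℝ (n := ∞) T
      rw [hT] at this
      exact this.comp_contDiffWithinAt z ((hS z hz).mono Set.inter_subset_left)
    exact contDiffOn_const.sub (R.contDiff.comp_contDiffOn
      (hinv.clm_apply ((hD.mono Set.inter_subset_left).clm_apply contDiffOn_const)))
  · simp [hu]
  · rintro z ⟨-, hz⟩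
    have := congr($(Ring.mul_inverse_cancel _ hz) (fderiv ℝ f z u))
    simp only [mul_apply_eq_comp, ContinuousLinearMap.comp_apply,
      one_apply_eq_self] at this
    rw [map_sub, this, sub_self]

namespace LagrangianSubmersion


/-! ### Extension of vertical vectors to global vertical fields -/

section VerticalExtension

variable {E : Type*} [NormedAddCommGroup E] [NormedSpace ℝ E]
  {M : Type*} [TopologicalSpace M] [ChartedSpace E M] [IsManifold 𝓘(ℝ, E) ∞ M]
  {F : Type*} [NormedAddCommGroup F] [NormedSpace ℝ F]
  {B : Type*} [TopologicalSpace B] [ChartedSpace F B] [IsManifold 𝓘(ℝ, F) ∞ B]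

/-- The derivative of `p` in charts is the derivative of its coordinate expression. -/
theorem mfderiv_extChartAt_comp_mfderiv {p : M → B} {x y : M} {b : B}
    (hp : MDiffAt p y) (hy : y ∈ (chartAt E x).source) (hpy : p y ∈ (chartAt F b).source)
    (hpc : DifferentiableAt ℝ
      (extChartAt 𝓘(ℝ, F) b ∘ p ∘ (extChartAt 𝓘(ℝ, E) x).symm) (extChartAt 𝓘(ℝ, E) x y)) :
    (mfderiv 𝓘(ℝ, F) 𝓘(ℝ, F) (extChartAt 𝓘(ℝ, F) b) (p y)).comp
        (mfderiv 𝓘(ℝ, E) 𝓘(ℝ, F) p y) =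
      (fderiv ℝ (extChartAt 𝓘(ℝ, F) b ∘ p ∘ (extChartAt 𝓘(ℝ, E) x).symm)
        (extChartAt 𝓘(ℝ, E) x y)).comp
        (mfderiv 𝓘(ℝ, E) 𝓘(ℝ, E) (extChartAt 𝓘(ℝ, E) x) y) := by
  have : IsManifold 𝓘(ℝ, E) 1 M := .of_le (n := ∞) (by simp)
  have : IsManifold 𝓘(ℝ, F) 1 B := .of_le (n := ∞) (by simp)
  rw [← mfderiv_comp y (mdifferentiableAt_extChartAt hpy) hp, ← mfderiv_eq_fderiv]
  erw [← mfderiv_comp y hpc.mdifferentiableAt (mdifferentiableAt_extChartAt hy)]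
  -- Both sides are now derivatives at `y` of composite maps that agree on the chart domain, where
  -- the chart and its inverse cancel.
  refine Filter.EventuallyEq.mfderiv_eq ?_
  filter_upwards [(chartAt E x).open_source.mem_nhds hy] with z hz
  simp [(chartAt E x).left_inv hz]

variable [FiniteDimensional ℝ E] [FiniteDimensional ℝ F] [T2Space M]

/-- Vertical vectors of a submersion extend to global smooth vertical fields. -/
theorem exists_isSection_vertical {p : M → B} (hp : ContMDiff 𝓘(ℝ, E) 𝓘(ℝ, F) ∞ p) {x : M}
    (hsurj : Function.Surjective (mfderiv 𝓘(ℝ, E) 𝓘(ℝ, F) p x))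
    {u : TangentSpace 𝓘(ℝ, E) x} (hu : u ∈ vertical E F p x) :
    ∃ U : Π x : M, TangentSpace 𝓘(ℝ, E) x, IsSection (vertical E F p) U ∧ U x = u := by
  have : IsManifold 𝓘(ℝ, E) 1 M := .of_le (n := ∞) (by simp)
  have : IsManifold 𝓘(ℝ, F) 1 B := .of_le (n := ∞) (by simp)
  set q : E → F := extChartAt 𝓘(ℝ, F) (p x) ∘ p ∘ (extChartAt 𝓘(ℝ, E) x).symm with hq
  set O : Set E := (extChartAt 𝓘(ℝ, E) x).target ∩
    (extChartAt 𝓘(ℝ, E) x).symm ⁻¹' (p ⁻¹' (extChartAt 𝓘(ℝ, F) (p x)).source) with hOdef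
  have hO : IsOpen O := (continuousOn_extChartAt_symm x).isOpen_inter_preimage
    (isOpen_extChartAt_target x) ((isOpen_extChartAt_source (p x)).preimage hp.continuous)
  have hqO : ContDiffOn ℝ ∞ q O := (contMDiff_iff.1 hp).2 x (p x)
  have hxO : extChartAt 𝓘(ℝ, E) x x ∈ O := by simp [hOdef]
  set e := trivializationAt E (TangentSpace 𝓘(ℝ, E) : M → Type _) x with he
  have hebase : e.baseSet = (chartAt E x).source := TangentBundle.trivializationAt_baseSet x
  -- In the trivialization `e`, the differential of `p` followed by that of the chart of `B` is the
  -- derivative of the coordinate map `q`. Since the chart differential is injective (`hinj`),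
  -- verticality can be tested on `fderiv ℝ q`.
  have key : ∀ y ∈ (chartAt E x).source, extChartAt 𝓘(ℝ, E) x y ∈ O →
      p y ∈ (chartAt F (p x)).source ∧ ∀ v : TangentSpace 𝓘(ℝ, E) y,
      mfderiv 𝓘(ℝ, F) 𝓘(ℝ, F) (extChartAt 𝓘(ℝ, F) (p x)) (p y)
        (mfderiv 𝓘(ℝ, E) 𝓘(ℝ, F) p y v) =
      fderiv ℝ q (extChartAt 𝓘(ℝ, E) x y) (e.continuousLinearMapAt ℝ y v) := by
    intro y hy hyO
    have hpy : p y ∈ (chartAt F (p x)).source := by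
      simpa [hOdef, (chartAt E x).left_inv hy, hy] using hyO
    refine ⟨hpy, fun v => ?_⟩
    have h := mfderiv_extChartAt_comp_mfderiv (b := p x) (hp.mdifferentiable (by simp) y) hy hpy
      ((hqO.contDiffAt (hO.mem_nhds hyO)).differentiableAt (by simp))
    have he' := TangentBundle.continuousLinearMapAt_trivializationAt (𝕜 := ℝ) (I := 𝓘(ℝ, E)) hy
    exact congr($h v).trans congr(fderiv ℝ q (extChartAt 𝓘(ℝ, E) x y) ($he' v)).symm
  have hxs := mem_chart_source E x
  have hinj : ∀ b ∈ (chartAt F (p x)).source, Function.Bijective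
      (mfderiv 𝓘(ℝ, F) 𝓘(ℝ, F) (extChartAt 𝓘(ℝ, F) (p x)) b) := fun b hb =>
    (isInvertible_mfderiv_extChartAt (by simpa using hb)).bijective
  obtain ⟨hpx, keyx⟩ := key x hxs hxO
  obtain ⟨U, hUO, hU, hxU, w, hw, hwx, hwU⟩ :=
    exists_contDiffOn_fderiv_apply_eq_zero hO hqO hxO (u := e.continuousLinearMapAt ℝ x u)
    (fun v => by
      obtain ⟨t, ht⟩ := ((hinj _ hpx).2.comp hsurj) v
      exact ⟨_, (keyx t).symm.trans ht⟩)
    (by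
      rw [← keyx u, show mfderiv 𝓘(ℝ, E) 𝓘(ℝ, F) p x u = 0 from hu]
      exact map_zero _)
  set N : Set M := (chartAt E x).source ∩ extChartAt 𝓘(ℝ, E) x ⁻¹' U with hNdef
  have hN : IsOpen N := by
    have := (continuousOn_extChartAt (I := 𝓘(ℝ, E)) x).isOpen_inter_preimage
      (isOpen_extChartAt_source x) hU
    rwa [extChartAt_source] at this
  -- The bump function equals 1 at `x` and has its closed support in `N`, so `f • W` is globally
  -- smooth and still takes the value `u` at `x`.
  obtain ⟨f, -, hf⟩ := (SmoothBumpFunction.nhds_basis_tsupport (I := 𝓘(ℝ, E)) x).mem_iff.1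
    (hN.mem_nhds ⟨hxs, hxU⟩)
  let W : Π y : M, TangentSpace 𝓘(ℝ, E) y := fun y => e.symmL ℝ y (w (extChartAt 𝓘(ℝ, E) x y))
  have hW : ContMDiffOn 𝓘(ℝ, E) (𝓘(ℝ, E).prod 𝓘(ℝ, E)) ∞ (fun y => TotalSpace.mk' E y (W y)) N := by
    rw [e.contMDiffOn_section_iff hN (hebase ▸ Set.inter_subset_left)]
    refine (hw.contMDiffOn.comp ((contMDiffOn_extChartAt (n := ∞)).mono Set.inter_subset_left)
      (fun y hy => hy.2)).congr fun y hy => ?_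
    have hyb : y ∈ e.baseSet := hebase ▸ hy.1
    simp only [W, Function.comp_apply]
    rw [e.symmL_apply hyb, e.mk_symm hyb, e.apply_symm_apply (e.mem_target.2 hyb)]
  refine ⟨(f : M → ℝ) • W, ⟨ContMDiffOn.smul_section_of_tsupport f.contMDiff.contMDiffOn hN hf hW,
    fun y => ?_⟩, ?_⟩
  · by_cases hy : y ∈ N
    · refine Submodule.smul_mem _ _ ?_
      obtain ⟨hpy, h⟩ := key y hy.1 (hUO hy.2)
      refine (hinj _ hpy).1 ?_
      have hyb : y ∈ e.baseSet := hebase ▸ hy.1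
      change mfderiv 𝓘(ℝ, F) 𝓘(ℝ, F) (extChartAt 𝓘(ℝ, F) (p x)) (p y)
        (mfderiv 𝓘(ℝ, E) 𝓘(ℝ, F) p y (W y)) = _
      rw [h, e.continuousLinearMapAt_symmL hyb, hwU _ hy.2]
      exact (map_zero _).symm
    · have : f y = 0 := image_eq_zero_of_notMem_tsupport fun h => hy (hf h)
      simp [this]
  · have hxb : x ∈ e.baseSet := hebase ▸ hxs
    rw [Pi.smul_apply', f.eq_one, one_smul]
    exact congr(e.symmL ℝ x $hwx).trans (e.symmL_continuousLinearMapAt hxb u)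

end VerticalExtension

/-! ### The pullback connection annihilates the zero section -/

section ZeroSection

variable {F : Type*} [NormedAddCommGroup F] [NormedSpace ℝ F]
  {B : Type*} [TopologicalSpace B] [ChartedSpace F B] [IsManifold 𝓘(ℝ, F) ∞ B]

theorem trivializationAt_zero (b c : B) :
    (trivializationAt F (fun y : B => TangentSpace 𝓘(ℝ, F) y) b ⟨c, 0⟩).2 = 0 := by
  rw [TangentBundle.trivializationAt_apply]
  exact map_zero _

theorem trivializationAt_symm_zero {b c : B} (hc : c ∈ (chartAt F b).source) :
    (trivializationAt F (fun y : B => TangentSpace 𝓘(ℝ, F) y) b).symm c 0 = 0 := by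
  rw [← TangentBundle.trivializationAt_baseSet (I := 𝓘(ℝ, F))] at hc
  rw [← Trivialization.symmL_apply (R := ℝ) _ hc, map_zero]

theorem eventually_extend_zero (b : B) :
    ∀ᶠ y in 𝓝 b, FiberBundle.extend F (E := fun y : B => TangentSpace 𝓘(ℝ, F) y)
      (0 : TangentSpace 𝓘(ℝ, F) b) y = 0 := by
  filter_upwards [(chartAt F b).open_source.mem_nhds (mem_chart_source F b)] with y hy
  rw [FiberBundle.extend, trivializationAt_zero, trivializationAt_symm_zero hy]

variable {E : Type*} [NormedAddCommGroup E] [NormedSpace ℝ E]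
  {M : Type*} [TopologicalSpace M] [ChartedSpace E M]
  [FiniteDimensional ℝ F] [RiemannianBundle (fun y : B => TangentSpace 𝓘(ℝ, F) y)]
  [IsContMDiffRiemannianBundle 𝓘(ℝ, F) ∞ F (fun y : B => TangentSpace 𝓘(ℝ, F) y)] {p : M → B}

/-- The coordinate function of the zero section is constant, which removes the first term. In the
second, the extension of the zero vector vanishes near `p x`, and the Levi-Civita connection is
local. -/
theorem pullbackDeriv_zero (x : M) (v : TangentSpace 𝓘(ℝ, E) x) :
    pullbackDeriv E F p (fun y => (0 : TangentSpace 𝓘(ℝ, F) (p y))) x v = 0 := by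
  have h : leviCivita F B (FiberBundle.extend F (0 : TangentSpace 𝓘(ℝ, F) (p x))) (p x) = 0 := by
    have := (leviCivita F B).isCovariantDerivativeOnUniv.congr_of_eventuallyEq
      (mdiff_extend (0 : TangentSpace 𝓘(ℝ, F) (p x))) (mdifferentiableAt_zeroSection ..)
      Filter.univ_mem (eventually_extend_zero (p x))
    exact this.trans congr($((leviCivita F B).zero) (p x))
  simp only [pullbackDeriv, h, trivializationAt_zero, mvfderiv_const]
  simp [trivializationAt_symm_zero]

end ZeroSection

/-! ### O'Neill's tensor and the second fundamental form on sections -/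

section Sections

variable {E : Type*} [NormedAddCommGroup E] [NormedSpace ℝ E]
  {M : Type*} [TopologicalSpace M] [ChartedSpace E M] [IsManifold 𝓘(ℝ, E) ∞ M]

theorem IsSmoothField.mdiff {X : Π x : M, TangentSpace 𝓘(ℝ, E) x} (hX : IsSmoothField X) (x : M) :
    MDiffAt (T% X) x :=
  ContMDiff.mdifferentiable hX (by simp) x

variable [RiemannianBundle (fun x : M => TangentSpace 𝓘(ℝ, E) x)]
  {F : Type*} [NormedAddCommGroup F] [NormedSpace ℝ F]
  {B : Type*} [TopologicalSpace B] [ChartedSpace F B] {p : M → B}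
  {J : Π x : M, TangentSpace 𝓘(ℝ, E) x →L[ℝ] TangentSpace 𝓘(ℝ, E) x}

theorem IsHermitian.isSmoothField_applyField (hJ : IsHermitian J)
    {X : Π x : M, TangentSpace 𝓘(ℝ, E) x} (hX : IsSmoothField X) :
    IsSmoothField (applyField J X) :=
  ContMDiff.clm_bundle_apply (E₁ := fun x : M => TangentSpace 𝓘(ℝ, E) x)
    (E₂ := fun x : M => TangentSpace 𝓘(ℝ, E) x) hJ.smooth hX

variable [FiniteDimensional ℝ E]
  [IsContMDiffRiemannianBundle 𝓘(ℝ, E) ∞ E (fun x : M => TangentSpace 𝓘(ℝ, E) x)]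

/-- For a horizontal field `X` and a vertical field `U`, `⟨U, ∇_V X⟩ = -⟨X, ∇_V U⟩`. -/
theorem inner_covDeriv_of_isSection {V X U : Π x : M, TangentSpace 𝓘(ℝ, E) x}
    (hV : IsSmoothField V) (hX : IsSection (horizontal E F p) X)
    (hU : IsSection (vertical E F p) U) (x : M) :
    inner ℝ (U x) (covDeriv V X x) = - inner ℝ (X x) (covDeriv V U x) := by
  have h := leviCivita_metric (hV.mdiff x) (hX.smooth.mdiff x) (hU.smooth.mdiff x)
  have h0 : (fun y => inner ℝ (X y) (U y)) = fun _ : M => (0 : ℝ) :=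
    funext fun y => Submodule.inner_left_of_mem_orthogonal (hU.mem y) (hX.mem y)
  rw [h0, mvfderiv_const, real_inner_comm] at h
  exact eq_neg_of_add_eq_zero_left h.symm

/-- The `ℋ∇𝒱` term drops out because `𝒱X = 0`. -/
theorem oneillT_of_isSection {V X : Π x : M, TangentSpace 𝓘(ℝ, E) x}
    (hV : IsSection (vertical E F p) V) (hX : IsSection (horizontal E F p) X) (x : M) :
    oneillT E F p V X x = (vertical E F p x).starProjection (covDeriv V X x) := by
  have h1 : vertProj E F p V = V :=
    funext fun y => Submodule.starProjection_eq_self_iff.2 (hV.mem y)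
  have h2 : horProj E F p X = X :=
    funext fun y => Submodule.starProjection_eq_self_iff.2 (hX.mem y)
  have h3 : vertProj E F p X = 0 :=
    funext fun y => (Submodule.starProjection_apply_eq_zero_iff _).2 (hX.mem y)
  have h4 : covDeriv V (0 : Π x : M, TangentSpace 𝓘(ℝ, E) x) = 0 :=
    funext fun y => by simp [covDeriv]
  simp [oneillT, h1, h2, h3, h4, vertProj, horProj]

theorem oneillT_eq_zero_iff {V X : Π x : M, TangentSpace 𝓘(ℝ, E) x}
    (hV : IsSection (vertical E F p) V) (hX : IsSection (horizontal E F p) X) (x : M) :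
    oneillT E F p V X x = 0 ↔ covDeriv V X x ∈ horizontal E F p x := by
  rw [oneillT_of_isSection hV hX, Submodule.starProjection_apply_eq_zero_iff, horizontal]

/-- Involutivity is automatic: the bracket is `∇_V W - ∇_W V`. -/
theorem isTotallyGeodesicFoliation_iff {D : Π x : M, Submodule ℝ (TangentSpace 𝓘(ℝ, E) x)} :
    IsTotallyGeodesicFoliation D ↔ ∀ V W : Π x : M, TangentSpace 𝓘(ℝ, E) x,
      IsSection D V → IsSection D W → ∀ x, covDeriv V W x ∈ D x := by
  refine ⟨fun h => h.covDeriv_mem, fun h => ⟨fun V W hV hW x => ?_, h⟩⟩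
  rw [← leviCivita_torsion (hV.smooth.mdiff x) (hW.smooth.mdiff x)]
  exact sub_mem (h V W hV hW x) (h W V hW hV x)

variable [IsManifold 𝓘(ℝ, F) ∞ B] [FiniteDimensional ℝ F]
  [RiemannianBundle (fun y : B => TangentSpace 𝓘(ℝ, F) y)]
  [IsContMDiffRiemannianBundle 𝓘(ℝ, F) ∞ F (fun y : B => TangentSpace 𝓘(ℝ, F) y)]

/-- Here `π_* W` is the zero section, so only `-π_*(∇_V W)` survives. -/
theorem secondFundamentalForm_eq_zero_iff {V W : Π x : M, TangentSpace 𝓘(ℝ, E) x}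
    (hW : IsSection (vertical E F p) W) (x : M) :
    secondFundamentalForm E F p V W x = 0 ↔ covDeriv V W x ∈ vertical E F p x := by
  have h : (fun y => mfderiv 𝓘(ℝ, E) 𝓘(ℝ, F) p y (W y)) = fun _ => 0 := funext hW.mem
  rw [secondFundamentalForm, h, pullbackDeriv_zero, zero_sub, neg_eq_zero]
  rfl

end Sections

/-! ### `J` exchanges vertical and horizontal fields -/

section Lagrangian

variable {E : Type*} [NormedAddCommGroup E] [NormedSpace ℝ E]
  {M : Type*} [TopologicalSpace M] [ChartedSpace E M] [IsManifold 𝓘(ℝ, E) ∞ M]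
  [RiemannianBundle (fun x : M => TangentSpace 𝓘(ℝ, E) x)]
  {F : Type*} [NormedAddCommGroup F] [NormedSpace ℝ F]
  {B : Type*} [TopologicalSpace B] [ChartedSpace F B]
  [RiemannianBundle (fun y : B => TangentSpace 𝓘(ℝ, F) y)]
  {J : Π x : M, TangentSpace 𝓘(ℝ, E) x →L[ℝ] TangentSpace 𝓘(ℝ, E) x} {p : M → B}

theorem IsLagrangianSubmersion.isSection_applyField_of_vertical (hJ : IsHermitian J)
    (hp : IsLagrangianSubmersion E F J p) {W : Π x : M, TangentSpace 𝓘(ℝ, E) x}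
    (hW : IsSection (vertical E F p) W) : IsSection (horizontal E F p) (applyField J W) where
  smooth := hJ.isSmoothField_applyField hW.smooth
  mem x := hp.map_vertical x ▸ Submodule.mem_map_of_mem (hW.mem x)

theorem IsLagrangianSubmersion.isSection_applyField_of_horizontal (hJ : IsHermitian J)
    (hp : IsLagrangianSubmersion E F J p) {X : Π x : M, TangentSpace 𝓘(ℝ, E) x}
    (hX : IsSection (horizontal E F p) X) : IsSection (vertical E F p) (applyField J X) where
  smooth := hJ.isSmoothField_applyField hX.smooth
  mem x := by
    have h := hX.mem x
    rw [← hp.map_vertical x] at h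
    obtain ⟨u, hu, hux⟩ := h
    have hux : J x u = X x := hux
    -- Writing `X = Ju` at the point `x` with `u` vertical, `JX = J²u = -u`.
    rw [applyField, ← hux, hJ.sq]
    exact neg_mem hu

end Lagrangian

end LagrangianSubmersion

/-! ### The equivalence -/

open LagrangianSubmersion
theorem corollary4p4
    {E : Type*} [NormedAddCommGroup E] [NormedSpace ℝ E] [FiniteDimensional ℝ E]
    {M : Type*} [TopologicalSpace M] [T2Space M] [SecondCountableTopology M]
    [ChartedSpace E M] [IsManifold 𝓘(ℝ, E) ∞ M]
    [RiemannianBundle (fun x : M => TangentSpace 𝓘(ℝ, E) x)]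
    [IsContMDiffRiemannianBundle 𝓘(ℝ, E) ∞ E (fun x : M => TangentSpace 𝓘(ℝ, E) x)]
    {F : Type*} [NormedAddCommGroup F] [NormedSpace ℝ F] [FiniteDimensional ℝ F]
    {B : Type*} [TopologicalSpace B] [T2Space B] [SecondCountableTopology B]
    [ChartedSpace F B] [IsManifold 𝓘(ℝ, F) ∞ B]
    [RiemannianBundle (fun y : B => TangentSpace 𝓘(ℝ, F) y)]
    [IsContMDiffRiemannianBundle 𝓘(ℝ, F) ∞ F (fun y : B => TangentSpace 𝓘(ℝ, F) y)]
    (J : Π x : M, TangentSpace 𝓘(ℝ, E) x →L[ℝ] TangentSpace 𝓘(ℝ, E) x)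
    (om : Π x : M, TangentSpace 𝓘(ℝ, E) x →L[ℝ] ℝ) (p : M → B)
    (hJ : IsHermitian J)
    (h_om : IsLeeForm J om)
    (hp : IsLagrangianSubmersion E F J p)
    (hB₁ : ∀ x, leeField om x ∈ vertical E F p x) :
    List.TFAE
      [IsTotallyGeodesicFoliation
          (fun x : M => vertical E F p x),
        ∀ V W : Π x : M, TangentSpace 𝓘(ℝ, E) x,
          IsSection (vertical E F p) V →
          IsSection (vertical E F p) W →
          ∀ x, oneillT E F p V (applyField J W) x = 0,
        ∀ V X : Π x : M, TangentSpace 𝓘(ℝ, E) x,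
          IsSection (vertical E F p) V →
          IsSection (horizontal E F p) X →
          ∀ x, secondFundamentalForm E F p V
            (applyField J X) x = 0] := by
  have extend {x : M} {u : TangentSpace 𝓘(ℝ, E) x} (hu : u ∈ vertical E F p x) :=
    exists_isSection_vertical hp.smooth (hp.mfderiv_surjective x) hu
  tfae_have 1 → 2 := by
    intro h V W hV hW x
    have hJW := hp.isSection_applyField_of_vertical hJ hW
    rw [oneillT_eq_zero_iff hV hJW]
    refine (Submodule.mem_orthogonal _ _).2 fun u hu => ?_
    obtain ⟨U, hU, rfl⟩ := extend hu
    rw [inner_covDeriv_of_isSection hV.smooth hJW hU, neg_eq_zero]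
    exact Submodule.inner_left_of_mem_orthogonal (h.covDeriv_mem V U hV hU x) (hJW.mem x)
  tfae_have 2 → 1 := by
    refine fun h => isTotallyGeodesicFoliation_iff.2 fun V W hV hW x => ?_
    -- Verticality of `∇_V W` is tested against horizontal vectors, each of which is `Ju` with `u`
    -- vertical; extending `u` to a field `U` makes the hypothesis on `𝒯_V JU` available.
    rw [← (vertical E F p x).orthogonal_orthogonal]
    refine (Submodule.mem_orthogonal _ _).2 fun z hz => ?_
    obtain ⟨u, hu, rfl⟩ : ∃ u ∈ vertical E F p x, J x u = z := by
      rwa [← horizontal, ← hp.map_vertical x] at hz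
    obtain ⟨U, hU, rfl⟩ := extend hu
    have hJU := hp.isSection_applyField_of_vertical hJ hU
    have h1 := (oneillT_eq_zero_iff hV hJU x).1 (h V U hV hU x)
    have h2 := inner_covDeriv_of_isSection hV.smooth hJU hW x
    rw [Submodule.inner_right_of_mem_orthogonal (hW.mem x) h1] at h2
    exact neg_eq_zero.1 h2.symm
  tfae_have 1 → 3 := by
    intro h V X hV hX x
    have hJX := hp.isSection_applyField_of_horizontal hJ hX
    exact (secondFundamentalForm_eq_zero_iff hJX x).2 (h.covDeriv_mem V _ hV hJX x)
  tfae_have 3 → 1 := by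
    refine fun h => isTotallyGeodesicFoliation_iff.2 fun V W hV hW x => ?_
    -- The horizontal field to use is `X = J(-W)`, the sign being chosen so that `JX = W`.
    have hW' : IsSection (vertical E F p) (-W) :=
      ⟨ContMDiff.neg_section hW.smooth, fun y => neg_mem (hW.mem y)⟩
    have hX := hp.isSection_applyField_of_vertical hJ hW'
    have hXW : applyField J (applyField J (-W)) = W := funext fun y => by
      simp [applyField, hJ.sq]
    exact (secondFundamentalForm_eq_zero_iff hW x).1 (hXW ▸ h V _ hV hX x)
  tfae_finish
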